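/- Let $K$ be a field and let $G$ be a finite connected simple graph (no loops, no multiple edges) on the vertex set $\{1,\dots,d\}$ with edges $e_1,\dots,e_n$. Let $A_{\vec G}\in\mathbb Z^{d\times n}$ be the matrix whose $k$-th column is $\mathbf e_i-\mathbf e_j$ if $e_k=\{i,j\}$ with $i<j$, where $\mathbf e_1,\dots,\mathbf e_d$ are the unit coordinate vectors, and let $$A_{\vec G}^{\pm}=\begin{bmatrix}\mathbf 0 & A_{\vec G} & -A_{\vec G}\\ 1 & 1\ \cdots\ 1 & 1\ \cdots\ 1\end{bmatrix}\in\mathbb Z^{(d+1)\times(2n+1)}$$ with columns $\mathbf a_1,\dots,\mathbf a_{2n+1}$. Let $K[A_{\vec G}^{\pm}]$ be the $K$-subalgebra of the Laurent polynomial ring $K[t_1^{\pm1},\dots,t_{d+1}^{\pm1}]$ generated by the Laurent monomials $\mathbf t^{\mathbf a_1},\dots,\mathbf t^{\mathbf a_{2n+1}}$, and let $I_{A_{\vec G}^{\pm}}$ be the kernel of the $K$-algebra homomorphism $K[\mathbf x]=K[x_1,\dots,x_{2n+1}]\to K[A_{\vec G}^{\pm}]$, $x_k\mapsto\mathbf t^{\mathbf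 a_k}$. Then there is a linear order of the variables $x_1,\dots,x_{2n+1}$ such that, for the (graded) reverse lexicographic order $<$ on the monomials of $K[\mathbf x]$ induced by it, the initial ideal $\mathrm{in}_<(I_{A_{\vec G}^{\pm}})$, that is, the ideal generated by the initial monomials of the nonzero elements of $I_{A_{\vec G}^{\pm}}$, is a radical ideal. Moreover, the ring $K[A_{\vec G}^{\pm}]$ is normal, that is, integrally closed in its field of fractions. Here $\mathbf x^{\mathbf u}<\mathbf x^{\mathbf v}$ in the reverse lexicographic order if $\deg\mathbf x^{\mathbf u}<\deg\mathbf x^{\mathbf v}$, or if the degrees are equal, $\mathbf u\ne\mathbf v$, and the smallest variable whose exponents in the two monomials differ has the larger exponent in $\mathbf x^{\mathbf u}$. -/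

import Mathlib

noncomputable section

/-! ### Reverse lexicographic orders -/

/-- The exponent vectors `σ →₀ ℕ`, to be ordered by the graded reverse lexicographic order attached
to a linear order of the variables `σ`. -/
def RevLex (σ : Type*) : Type _ := σ →₀ ℕ

namespace RevLex

variable {σ : Type*}

instance : AddCommMonoid (RevLex σ) := inferInstanceAs (AddCommMonoid (σ →₀ ℕ))

/-- The identity, from exponent vectors to the synonym `RevLex σ`. -/
def equiv : (σ →₀ ℕ) ≃+ RevLex σ := AddEquiv.refl _

/-- The total degree of `a`, followed by the exponents of `a`, listed from the smallest variable
on and compared in the reversed order of `ℕ`. -/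
def key (a : RevLex σ) : ℕ ×ₗ Lex (σ → ℕᵒᵈ) :=
  toLex ((equiv.symm a).degree, toLex fun i => OrderDual.toDual (equiv.symm a i))

theorem key_injective : Function.Injective (key (σ := σ)) := by
  intro a b h
  apply equiv.symm.injective
  ext i
  exact congrArg (fun p : ℕ ×ₗ Lex (σ → ℕᵒᵈ) => OrderDual.ofDual (ofLex (ofLex p).2 i)) h

theorem key_add (a b : RevLex σ) : key (a + b) = key a + key b := by
  unfold key
  rw [map_add, map_add]
  rfl

variable [LinearOrder σ] [Finite σ]

/-- Graded reverse lexicographic order; see `RevLex.lt_iff`. -/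
instance : LinearOrder (RevLex σ) := LinearOrder.lift' key key_injective

theorem lt_iff {a b : σ →₀ ℕ} : equiv a < equiv b ↔ a.degree < b.degree ∨
    a.degree = b.degree ∧ ∃ i, (∀ j < i, a j = b j) ∧ b i < a i := by
  change key (equiv a) < key (equiv b) ↔ _
  rw [Prod.Lex.lt_iff]
  rfl

instance : IsOrderedAddMonoid (RevLex σ) where
  add_le_add_left a b h c := by
    change key (a + c) ≤ key (b + c)
    rw [key_add, key_add]
    exact add_le_add_left (α := ℕ ×ₗ Lex (σ → ℕᵒᵈ)) h _

theorem equiv_monotone : Monotone (equiv (σ := σ)) := by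
  intro a b h
  rcases h.eq_or_lt with rfl | h
  · exact le_rfl
  refine (lt_iff.2 (Or.inl ?_)).le
  obtain ⟨c, rfl⟩ := le_iff_exists_add.1 h.le
  rw [map_add]
  have : c.degree ≠ 0 := by
    rw [Ne, Finsupp.degree_eq_zero_iff]
    rintro rfl
    simp at h
  omega

instance : WellFoundedLT (RevLex σ) :=
  have := equiv_monotone.wellQuasiOrderedLE_of_wellQuasiOrderedLE_of_surjective
    (equiv (σ := σ)).surjective
  inferInstance

end RevLex

/-- The (graded) reverse lexicographic order on the monomials in the finitely many variables `σ`,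
induced by a linear order `o` of the variables: `a < b` iff `deg a < deg b`, or `deg a = deg b` and
for the smallest variable `i` at which `a` and `b` differ one has `a i > b i`. -/
def revLexOrder {σ : Type*} [Finite σ] (o : LinearOrder σ) : MonomialOrder σ :=
  letI := o
  { syn := RevLex σ
    toSyn := RevLex.equiv
    toSyn_monotone := RevLex.equiv_monotone }

/-- The initial ideal of `I`: the ideal generated by the initial monomials of the nonzero elements
of `I`. -/
def initialIdeal {σ K : Type*} [Field K] (m : MonomialOrder σ) (I : Ideal (MvPolynomial σ K)) :
    Ideal (MvPolynomial σ K) :=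
  Ideal.span {p | ∃ f ∈ I, f ≠ 0 ∧ p = MvPolynomial.monomial (m.degree f) 1}

/-! ### Toric rings and toric ideals

The Laurent polynomial ring over `K` in variables `t i`, `i : m`, is the group algebra
`AddMonoidAlgebra K (m → ℤ)`. -/

/-- The Laurent monomial `t ^ a`. -/
def laurentMonomial (K : Type*) [Field K] {m : Type*} (a : m → ℤ) : AddMonoidAlgebra K (m → ℤ) :=
  AddMonoidAlgebra.single a 1

/-- The toric ring `K[A]`, generated by the Laurent monomials of the columns of `A`. -/
def toricRing (K : Type*) [Field K] {m n : Type*} (A : Matrix m n ℤ) :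
    Subalgebra K (AddMonoidAlgebra K (m → ℤ)) :=
  Algebra.adjoin K (Set.range fun j => laurentMonomial K (A.col j))

/-- The toric ideal `I_A`, the kernel of `x j ↦ t ^ (j-th column of A)`. -/
def toricIdeal (K : Type*) [Field K] {m n : Type*} (A : Matrix m n ℤ) :
    Ideal (MvPolynomial n K) :=
  RingHom.ker (MvPolynomial.aeval (R := K) fun j => laurentMonomial K (A.col j))

/-- The centrally symmetric configuration `A^±`: the columns are `(0, 1)`, then `(a, 1)` for the
columns `a` of `A`, then `(-a, 1)` for the columns `a` of `A`. -/
def centrallySymmetric {m n : Type*} (A : Matrix m n ℤ) :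
    Matrix (m ⊕ Unit) (Unit ⊕ (n ⊕ n)) ℤ :=
  Matrix.fromBlocks 0 (Matrix.fromCols A (-A)) (Matrix.of fun _ _ => 1) (Matrix.of fun _ _ => 1)

/-- The matrix whose columns, indexed by the edges of `G`, are `e_i - e_j` for the edge `{i, j}`
with `i < j`. -/
def orientedIncidence {d : ℕ} (G : SimpleGraph (Fin d)) : Matrix (Fin d) G.edgeSet ℤ :=
  Matrix.of fun v e =>
    (Pi.single (e : Sym2 (Fin d)).inf 1 - Pi.single (e : Sym2 (Fin d)).sup 1 : Fin d → ℤ) v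

end

/-! Make the variable of the column (0,1) the smallest. A monomial is initial for an element of the
toric ideal exactly when it is not the minimum of its fibre, so radicality amounts to this: if n·a
is not minimal, neither is a (`exists_toricDegree_eq_lt_of_nsmul`).

The columns of [A, -A] are arcs of a digraph, so integral kernel vectors are circulations, and these
are conformal sums of circulations with entries 0, ±1. If b beats n·a, then w = b - n·a restricts to
such a circulation. A summand c of nonpositive sum, balanced at the smallest variable, can be added
to a, because w_j < 0 forces a_j > 0. Some summand has negative sum, or has sum zero and is nonzero
at the variable deciding b < n·a; adding it beats a.

The same lemma gives normality. If s + k·g lies in the monoid of exponents for all k, then some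
positive multiple of g does (Dickson), and so does g + N·(0,1) for some N (central symmetry).
Multiples of the minimal u over g + N·(0,1) stay minimal, which forces u to contain N copies of the
smallest variable; removing them represents g. Leading exponents carry this saturation over to the
ring, inside the integrally closed Laurent polynomial ring. -/

/-! ### Conformal decomposition of circulations -/

open Finset in
/-- A nonzero circulation on a finite digraph dominates the indicator of a set of disjoint cycles. -/
theorem exists_circulation_le_one {V J : Type*} [Finite V] [DecidableEq V] [Fintype J]
    (s t : J → V) (y : J → ℕ) (hy : y ≠ 0)
    (h : ∑ j, (y j : ℤ) • (Pi.single (s j) 1 - Pi.single (t j) 1 : V → ℤ) = 0) :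
    ∃ c : J → ℕ, c ≠ 0 ∧ (∀ j, c j ≤ 1) ∧ (∀ j, y j = 0 → c j = 0) ∧
      ∑ j, (c j : ℤ) • (Pi.single (s j) 1 - Pi.single (t j) 1 : V → ℤ) = 0 := by
  classical
  have bal : ∀ (c : J → ℕ) (v : V),
      (∑ j, (c j : ℤ) • (Pi.single (s j) 1 - Pi.single (t j) 1 : V → ℤ)) v =
        ((∑ j with s j = v, c j : ℕ) : ℤ) - (∑ j with t j = v, c j : ℕ) := by
    intro c v
    simp only [Finset.sum_apply, Pi.smul_apply, Pi.sub_apply, Pi.single_apply, smul_eq_mul,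
      mul_sub, Finset.sum_sub_distrib, mul_ite, mul_one, mul_zero, Finset.sum_filter, Nat.cast_sum,
      Nat.cast_ite, Nat.cast_zero, eq_comm (a := v)]
  let W := {v : V // ∃ j, s j = v ∧ y j ≠ 0}
  -- By balance, a vertex entered by the support is also left by it, so following arcs never gets
  -- stuck.
  have next : ∀ j, y j ≠ 0 → ∃ j', s j' = t j ∧ y j' ≠ 0 := by
    intro j hj
    by_contra! hc
    have h1 := bal y (t j)
    rw [h, Finset.sum_eq_zero (s := univ.filter fun k => s k = t j)
      (fun k hk => hc k (by simpa using hk))] at h1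
    have : y j ≤ ∑ k with t k = t j, y k :=
      Finset.single_le_sum (f := y) (fun _ _ => Nat.zero_le _) (by simp)
    simp only [Pi.zero_apply] at h1
    omega
  choose out hout hout' using fun v : W => v.2
  let f : W → W := fun v => ⟨t (out v), next _ (hout' v)⟩
  obtain ⟨j0, hj0⟩ := Function.ne_iff.1 hy
  have : Nonempty W := ⟨⟨s j0, j0, rfl, hj0⟩⟩
  obtain ⟨v0, hv0⟩ : (Function.periodicPts f).Nonempty := by
    obtain ⟨a, b, hab, he⟩ := Finite.exists_ne_map_eq_of_infinite
      (fun n : ℕ => f^[n] (Classical.arbitrary W))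
    wlog hlt : a < b generalizing a b
    · exact this b a hab.symm he.symm (by omega)
    refine ⟨f^[a] (Classical.arbitrary W), Function.mk_mem_periodicPts (Nat.sub_pos_of_lt hlt) ?_⟩
    change f^[b - a] (f^[a] _) = _
    rw [← Function.iterate_add_apply, Nat.sub_add_cancel hlt.le]
    exact he.symm
  have hbij := Function.bijOn_periodicPts f
  -- The chosen arcs leaving periodic vertices. Since `f` permutes these vertices, each has one such
  -- arc in and one out.
  let c : J → ℕ := fun j => if ∃ v ∈ Function.periodicPts f, out v = j then 1 else 0
  have hc1 : ∀ v ∈ Function.periodicPts f, c (out v) = 1 := fun v hv => if_pos ⟨v, hv, rfl⟩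
  have hc0 : ∀ j, c j ≠ 0 → ∃ v ∈ Function.periodicPts f, out v = j := by
    intro j hj
    by_contra hn
    exact hj (if_neg hn)
  refine ⟨c, ?_, ?_, ?_, ?_⟩
  · intro h0
    have := hc1 v0 hv0
    rw [h0] at this
    simp at this
  · intro j
    simp only [c]
    split_ifs <;> simp
  · intro j hj
    by_contra hn
    obtain ⟨v, -, rfl⟩ := hc0 j hn
    exact hout' v hj
  · ext v
    rw [bal, Pi.zero_apply, sub_eq_zero, Nat.cast_inj]
    by_cases hv : ∃ w ∈ Function.periodicPts f, w.1 = v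
    · obtain ⟨w, hw, rfl⟩ := hv
      obtain ⟨u, hu, huw⟩ := hbij.surjOn hw
      rw [Finset.sum_eq_single_of_mem (out w) (by simp [hout]),
        Finset.sum_eq_single_of_mem (out u) (by simpa [f] using congrArg Subtype.val huw),
        hc1 w hw, hc1 u hu]
      · intro j hj hne
        by_contra hn
        obtain ⟨u', hu', rfl⟩ := hc0 j hn
        refine hne (congrArg out (hbij.injOn hu' hu ?_))
        rw [huw]
        exact Subtype.ext (by simpa using hj)
      · intro j hj hne
        by_contra hn
        obtain ⟨u', hu', rfl⟩ := hc0 j hn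
        refine hne (congrArg out (Subtype.ext ?_))
        rw [← hout]
        simpa using hj
    · rw [Finset.sum_eq_zero, Finset.sum_eq_zero]
      · intro j hj
        by_contra hn
        obtain ⟨u, hu, rfl⟩ := hc0 j hn
        exact hv ⟨f u, hbij.mapsTo hu, by simpa using hj⟩
      · intro j hj
        by_contra hn
        obtain ⟨u, hu, rfl⟩ := hc0 j hn
        exact hv ⟨u, hu, by rw [← hout]; simpa using hj⟩

/-- Every column of `N` is a difference of two unit vectors. -/
def IsNetworkMatrix {V J : Type*} [DecidableEq V] (N : Matrix V J ℤ) : Prop :=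
  ∀ j, ∃ u v, N.col j = Pi.single u 1 - Pi.single v 1

/-- Every entry of `c` is zero or the sign of the corresponding entry of `w`. -/
def IsSignPart {J : Type*} (c w : J → ℤ) : Prop :=
  ∀ j, c j = 0 ∨ c j = (w j).sign

open Matrix

theorem Matrix.mulVec_eq_sum_col {V J : Type*} [Fintype J] (N : Matrix V J ℤ) (w : J → ℤ) :
    N *ᵥ w = ∑ j, w j • N.col j := by
  ext v
  simp [Matrix.mulVec, dotProduct, mul_comm]

/-- Reversing the arcs where `w` is not positive turns `w` into the nonnegative circulation |w|, to
which the cycle extraction applies. -/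
theorem IsNetworkMatrix.exists_isSignPart {V J : Type*} [Finite V] [DecidableEq V] [Fintype J]
    {N : Matrix V J ℤ} (hN : IsNetworkMatrix N) {w : J → ℤ} (hw : w ≠ 0) (h : N *ᵥ w = 0) :
    ∃ c, c ≠ 0 ∧ IsSignPart c w ∧ N *ᵥ c = 0 := by
  choose u v huv using hN
  have key : ∀ y : J → ℕ, ∑ j, (y j : ℤ) • (Pi.single (if 0 < w j then u j else v j) 1 -
      Pi.single (if 0 < w j then v j else u j) 1 : V → ℤ) =
      N *ᵥ fun j => (if 0 < w j then 1 else -1) * (y j : ℤ) := by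
    intro y
    rw [Matrix.mulVec_eq_sum_col]
    refine Finset.sum_congr rfl fun j _ => ?_
    rw [huv]
    split_ifs
    · rw [one_mul]
    · rw [neg_one_mul, neg_smul, ← smul_neg, neg_sub]
  obtain ⟨c, hc, hc1, hc0, hker⟩ := exists_circulation_le_one
    (fun j => if 0 < w j then u j else v j) (fun j => if 0 < w j then v j else u j)
    (fun j => (w j).natAbs) (fun h0 => hw (by
      ext j
      simpa using congrFun h0 j)) (by
      rw [key, ← h]
      congr 1
      ext j
      split_ifs <;> omega)
  refine ⟨fun j => (if 0 < w j then 1 else -1) * (c j : ℤ), ?_, ?_, ?_⟩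
  · obtain ⟨j, hj⟩ := Function.ne_iff.1 hc
    refine Function.ne_iff.2 ⟨j, ?_⟩
    simp only [Pi.zero_apply] at hj ⊢
    split_ifs <;> omega
  · intro j
    rcases Nat.le_one_iff_eq_zero_or_eq_one.1 (hc1 j) with h' | h'
    · left
      simp [h']
    · right
      have hwj : w j ≠ 0 := fun h0 => by
        have := hc0 j (by simp [h0])
        omega
      simp only [h']
      split_ifs with hp
      · simp [Int.sign_eq_one_of_pos hp]
      · rw [Int.sign_eq_neg_one_of_neg (by omega)]
        simp
  · rw [← key, hker]

/-- Integral kernel vectors of a network matrix are conformal sums of kernel vectors with entries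
in `{0, 1, -1}`. -/
theorem IsNetworkMatrix.exists_list_isSignPart {V J : Type*} [Finite V] [DecidableEq V] [Fintype J]
    {N : Matrix V J ℤ} (hN : IsNetworkMatrix N) (w : J → ℤ) (h : N *ᵥ w = 0) :
    ∃ l : List (J → ℤ), l.sum = w ∧ ∀ c ∈ l, IsSignPart c w ∧ N *ᵥ c = 0 := by
  induction hn : ∑ j, (w j).natAbs using Nat.strong_induction_on generalizing w with
  | _ n ih =>
  by_cases hw : w = 0
  · exact ⟨[], by simp [hw]⟩
  obtain ⟨c, hc, hcw, hcN⟩ := hN.exists_isSignPart hw h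
  have hsign : ∀ j, c j = 0 ∨ c j = (w j).sign := hcw
  -- Subtracting a sign part never flips a sign, so sign parts of `w - c` are sign parts of `w`, and
  -- the ℓ¹-norm drops.
  have habs : ∀ j, (w j - c j).natAbs ≤ (w j).natAbs ∧ ((w j - c j).sign = 0 ∨
      (w j - c j).sign = (w j).sign) ∧ (c j ≠ 0 → (w j - c j).natAbs < (w j).natAbs) := by
    intro j
    have hj := hsign j
    rcases lt_trichotomy (w j) 0 with h0 | h0 | h0
    · rw [Int.sign_eq_neg_one_of_neg h0] at hj ⊢
      refine ⟨by omega, ?_, by omega⟩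
      rw [Int.sign_eq_neg_one_iff_neg, Int.sign_eq_zero_iff_zero]
      omega
    · rw [h0, Int.sign_zero] at hj
      simp [h0, or_self_iff.1 hj]
    · rw [Int.sign_eq_one_of_pos h0] at hj ⊢
      refine ⟨by omega, ?_, by omega⟩
      rw [Int.sign_eq_one_iff_pos, Int.sign_eq_zero_iff_zero]
      omega
  obtain ⟨j0, hj0⟩ := Function.ne_iff.1 hc
  obtain ⟨l, hl, hlc⟩ := ih _ (by
    rw [← hn]
    exact Finset.sum_lt_sum (fun j _ => (habs j).1) ⟨j0, Finset.mem_univ _, (habs j0).2.2 hj0⟩)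
    (w - c) (by rw [Matrix.mulVec_sub, h, hcN, sub_zero]) rfl
  refine ⟨c :: l, by simp [hl], ?_⟩
  rintro c' hc'
  rcases List.mem_cons.1 hc' with rfl | hc'
  · exact ⟨hcw, hcN⟩
  refine ⟨fun j => ?_, (hlc c' hc').2⟩
  rcases (hlc c' hc').1 j with h' | h'
  · exact Or.inl h'
  · rw [h']
    exact (habs j).2.1

theorem List.sum_apply_sum {J : Type*} [Fintype J] (l : List (J → ℤ)) :
    ∑ j, l.sum j = (l.map fun c => ∑ j, c j).sum := by
  induction l with
  | nil => simp
  | cons c l ih => simp [Finset.sum_add_distrib, ih]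

theorem IsNetworkMatrix.exists_isSignPart_sum_neg {V J : Type*} [Finite V] [DecidableEq V]
    [Fintype J] {N : Matrix V J ℤ} (hN : IsNetworkMatrix N) {w : J → ℤ} (h : N *ᵥ w = 0)
    (hw : ∑ j, w j < 0) : ∃ c, IsSignPart c w ∧ N *ᵥ c = 0 ∧ ∑ j, c j < 0 := by
  obtain ⟨l, hl, hlc⟩ := hN.exists_list_isSignPart w h
  by_contra! hc
  refine hw.not_ge ?_
  rw [← hl, List.sum_apply_sum]
  exact List.sum_nonneg fun x hx => by
    obtain ⟨c, hcl, rfl⟩ := List.mem_map.1 hx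
    exact hc c (hlc c hcl).1 (hlc c hcl).2

theorem IsNetworkMatrix.exists_isSignPart_sum_eq_zero {V J : Type*} [Finite V] [DecidableEq V]
    [Fintype J] {N : Matrix V J ℤ} (hN : IsNetworkMatrix N) {w : J → ℤ} (h : N *ᵥ w = 0)
    (hw : ∑ j, w j = 0) {i : J} (hi : w i ≠ 0) :
    ∃ c, IsSignPart c w ∧ N *ᵥ c = 0 ∧ (∑ j, c j < 0 ∨ ∑ j, c j = 0 ∧ c i ≠ 0) := by
  obtain ⟨l, hl, hlc⟩ := hN.exists_list_isSignPart w h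
  by_contra! hc
  have hnonneg : ∀ c ∈ l, 0 ≤ ∑ j, c j := fun c hcl => (hc c (hlc c hcl).1 (hlc c hcl).2).1
  -- Nonnegative numbers with total zero all vanish; every summand then vanishes at `i`,
  -- contradicting `w i ≠ 0`.
  have hzero : ∀ c ∈ l, ∑ j, c j = 0 := fun c hcl =>
    List.all_zero_of_le_zero_le_of_sum_eq_zero (l := l.map fun c => ∑ j, c j)
      (fun x hx => by
        obtain ⟨c, hcl, rfl⟩ := List.mem_map.1 hx
        exact hnonneg c hcl)
      (by rw [← List.sum_apply_sum, hl, hw]) (List.mem_map_of_mem hcl)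
  refine hi ?_
  rw [← hl, Pi.list_sum_apply]
  refine List.sum_eq_zero fun x hx => ?_
  obtain ⟨c, hcl, rfl⟩ := List.mem_map.1 hx
  exact (hc c (hlc c hcl).1 (hlc c hcl).2).2 (hzero c hcl)

/-! ### Minimality in the fibres of the centrally symmetric configuration -/

theorem isNetworkMatrix_fromCols_neg {V J : Type*} [DecidableEq V] {A : Matrix V J ℤ}
    (hA : IsNetworkMatrix A) : IsNetworkMatrix (fromCols A (-A)) := by
  rintro (j | j) <;> obtain ⟨u, v, h⟩ := hA j
  · exact ⟨u, v, h⟩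
  · refine ⟨v, u, ?_⟩
    rw [← neg_sub, ← h]
    rfl

theorem isNetworkMatrix_orientedIncidence {d : ℕ} (G : SimpleGraph (Fin d)) :
    IsNetworkMatrix (orientedIncidence G) :=
  fun _ => ⟨_, _, rfl⟩

theorem centrallySymmetric_mulVec_eq_zero_iff {V J : Type*} [Fintype J] {A : Matrix V J ℤ}
    {w : Unit ⊕ (J ⊕ J) → ℤ} : centrallySymmetric A *ᵥ w = 0 ↔
      fromCols A (-A) *ᵥ (w ∘ Sum.inr) = 0 ∧ w (Sum.inl ()) + ∑ j, w (Sum.inr j) = 0 := by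
  rw [centrallySymmetric, fromBlocks_mulVec, funext_iff, Sum.forall, funext_iff]
  refine and_congr (by simp) ?_
  simp [mulVec, dotProduct]

theorem revLexOrder_lt_iff {σ : Type*} [Finite σ] (o : LinearOrder σ) {a b : σ →₀ ℕ} :
    (revLexOrder o).toSyn a < (revLexOrder o).toSyn b ↔ a.degree < b.degree ∨
      a.degree = b.degree ∧ ∃ i, (∀ j, o.lt j i → a j = b j) ∧ b i < a i :=
  let := o
  RevLex.lt_iff

/-- The exponent of the Laurent monomial to which the monomial with exponent `a` is mapped. -/
noncomputable def toricDegree {m n : Type*} (A : Matrix m n ℤ) : (n →₀ ℕ) →ₗ[ℕ] (m → ℤ) :=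
  Finsupp.linearCombination ℕ A.col

theorem toricDegree_eq_mulVec {m n : Type*} [Fintype n] (A : Matrix m n ℤ) (a : n →₀ ℕ) :
    toricDegree A a = A *ᵥ fun j => (a j : ℤ) := by
  rw [Matrix.mulVec_eq_sum_col, toricDegree, Finsupp.linearCombination_apply,
    Finsupp.sum_fintype _ _ (by simp)]
  simp

theorem exists_toricDegree_eq_add {V J : Type*} [Fintype J] {A : Matrix V J ℤ}
    (a : Unit ⊕ (J ⊕ J) →₀ ℕ) {w : Unit ⊕ (J ⊕ J) → ℤ} (h : centrallySymmetric A *ᵥ w = 0)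
    (hw : ∀ j, 0 ≤ a j + w j) : ∃ b : Unit ⊕ (J ⊕ J) →₀ ℕ, (∀ j, (b j : ℤ) = a j + w j) ∧
      b.degree = a.degree ∧
      toricDegree (centrallySymmetric A) b = toricDegree (centrallySymmetric A) a := by
  have hb : ∀ j, ((Finsupp.equivFunOnFinite.symm fun j => (a j + w j).toNat) j : ℤ) = a j + w j :=
    fun j => by simpa using hw j
  refine ⟨Finsupp.equivFunOnFinite.symm fun j => (a j + w j).toNat, hb, ?_, ?_⟩
  · have h2 := (centrallySymmetric_mulVec_eq_zero_iff.1 h).2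
    rw [Finsupp.degree_eq_sum, Finsupp.degree_eq_sum, ← Nat.cast_inj (R := ℤ), Nat.cast_sum,
      Nat.cast_sum, Finset.sum_congr rfl fun j _ => hb j, Finset.sum_add_distrib,
      Fintype.sum_sum_type w]
    simp only [Finset.univ_unique, Finset.sum_singleton, PUnit.default_eq_unit, h2, add_zero]
  · rw [toricDegree_eq_mulVec, toricDegree_eq_mulVec, funext hb]
    change _ *ᵥ ((fun j => (a j : ℤ)) + w) = _
    rw [Matrix.mulVec_add, h, add_zero]

/-- If `n • a` is not minimal in its fibre, then neither is `a`. -/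
theorem exists_toricDegree_eq_lt_of_nsmul {V J : Type*} [Finite V] [DecidableEq V] [Finite J]
    {A : Matrix V J ℤ} (hA : IsNetworkMatrix A) {o : LinearOrder (Unit ⊕ (J ⊕ J))}
    (ho : ∀ j, o.le (Sum.inl ()) j) {a b : Unit ⊕ (J ⊕ J) →₀ ℕ} {n : ℕ}
    (hb : toricDegree (centrallySymmetric A) b = toricDegree (centrallySymmetric A) (n • a))
    (hlt : (revLexOrder o).toSyn b < (revLexOrder o).toSyn (n • a)) :
    ∃ b', toricDegree (centrallySymmetric A) b' = toricDegree (centrallySymmetric A) a ∧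
      (revLexOrder o).toSyn b' < (revLexOrder o).toSyn a := by
  have := Fintype.ofFinite J
  have hN := isNetworkMatrix_fromCols_neg hA
  set w : Unit ⊕ (J ⊕ J) → ℤ := fun j => b j - n * a j with hw
  have hker : centrallySymmetric A *ᵥ w = 0 := by
    have : w = (fun j => (b j : ℤ)) - fun j => ((n • a) j : ℤ) := by
      ext j
      simp [w]
    rw [this, Matrix.mulVec_sub, ← toricDegree_eq_mulVec, ← toricDegree_eq_mulVec, hb, sub_self]
  obtain ⟨hNw, hsum⟩ := centrallySymmetric_mulVec_eq_zero_iff.1 hker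
  -- a sign part of `w` can be added to `a`
  have main : ∀ c : J ⊕ J → ℤ, IsSignPart c (w ∘ Sum.inr) → fromCols A (-A) *ᵥ c = 0 →
      ∑ j, c j ≤ 0 → ∃ b' : Unit ⊕ (J ⊕ J) →₀ ℕ,
        ((b' (Sum.inl ()) : ℤ) = a (Sum.inl ()) - ∑ j, c j) ∧
        (∀ j, (b' (Sum.inr j) : ℤ) = a (Sum.inr j) + c j) ∧ b'.degree = a.degree ∧
        toricDegree (centrallySymmetric A) b' = toricDegree (centrallySymmetric A) a := by
    intro c hc hcN hc0
    obtain ⟨b', h1, h2, h3⟩ := exists_toricDegree_eq_add (A := A) a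
      (w := Sum.elim (fun _ => -∑ j, c j) c)
      (centrallySymmetric_mulVec_eq_zero_iff.2 ⟨by simpa using hcN, by simp⟩) (by
        rintro (j | j)
        · simp only [Sum.elim_inl]
          omega
        · simp only [Sum.elim_inr]
          rcases hc j with h | h
          · omega
          · have hwj : w (Sum.inr j) = b (Sum.inr j) - n * a (Sum.inr j) := rfl
            -- If a_j = 0 then w_j = b_j ≥ 0, so c_j ≥ 0; otherwise a_j ≥ 1 absorbs c_j ≥ -1.
            rcases Nat.eq_zero_or_pos (a (Sum.inr j)) with h0 | h0
            · have := Int.sign_nonneg_iff.2 (show 0 ≤ (w ∘ Sum.inr) j by simp [hwj, h0])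
              omega
            · have : -1 ≤ ((w ∘ Sum.inr) j).sign := by
                rcases Int.sign_trichotomy ((w ∘ Sum.inr) j) with h | h | h <;> omega
              omega)
    exact ⟨b', by simpa [sub_eq_add_neg] using h1 (Sum.inl ()), fun j => h1 (Sum.inr j),
      h2, h3⟩
  have hbot : ∀ j, ¬ o.lt j (Sum.inl ()) := fun j => let := o; not_lt.2 (ho j)
  have hdrop : ∀ c : J ⊕ J → ℤ, IsSignPart c (w ∘ Sum.inr) → fromCols A (-A) *ᵥ c = 0 →
      ∑ j, c j < 0 → ∃ b', toricDegree (centrallySymmetric A) b' =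
        toricDegree (centrallySymmetric A) a ∧
        (revLexOrder o).toSyn b' < (revLexOrder o).toSyn a := by
    intro c hc hcN hc0
    obtain ⟨b', h1, -, h3, h4⟩ := main c hc hcN hc0.le
    exact ⟨b', h4, (revLexOrder_lt_iff o).2 (Or.inr ⟨h3, Sum.inl (),
      fun j hj => (hbot j hj).elim, by omega⟩)⟩
  rcases (revLexOrder_lt_iff o).1 hlt with hdeg | ⟨-, i, hi, hi'⟩
  -- The row of ones makes fibres homogeneous, so the degrees cannot differ.
  · exfalso
    have h1 : ∑ j, w j = 0 := by
      rw [Fintype.sum_sum_type]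
      simpa using hsum
    simp only [w, Finset.sum_sub_distrib] at h1
    rw [Finsupp.degree_eq_sum, Finsupp.degree_eq_sum] at hdeg
    simp only [Finsupp.smul_apply, smul_eq_mul] at hdeg
    zify at hdeg
    omega
  · have hwi : ∀ j, o.lt j i → w j = 0 := fun j hj => by simp [w, hi j hj]
    have hwi' : 0 < w i := by
      simp only [Finsupp.smul_apply, smul_eq_mul] at hi'
      zify at hi'
      simp only [w]
      omega
    rcases i with u | i
    · obtain ⟨c, hc, hcN, hc0⟩ := hN.exists_isSignPart_sum_neg hNw
        (show ∑ j, w (Sum.inr j) < 0 by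
          have : 0 < w (Sum.inl ()) := hwi'
          omega)
      exact hdrop c hc hcN hc0
    · have hz : w (Sum.inl ()) = 0 := hwi _ (let := o; lt_of_le_of_ne (ho _) (by simp))
      obtain ⟨c, hc, hcN, hc0⟩ := hN.exists_isSignPart_sum_eq_zero hNw
        (show ∑ j, w (Sum.inr j) = 0 by omega) (i := i) hwi'.ne'
      rcases hc0 with hc0 | ⟨hc0, hci⟩
      · exact hdrop c hc hcN hc0
      obtain ⟨b', h1, h2, h3, h4⟩ := main c hc hcN hc0.le
      refine ⟨b', h4, (revLexOrder_lt_iff o).2 (Or.inr ⟨h3, Sum.inr i, ?_, ?_⟩)⟩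
      -- Below `i` the vector `w` vanishes, hence so does its sign part; at `i` the exponent grows
      -- by one.
      · rintro (j | j) hj
        · have : (b' (Sum.inl ()) : ℤ) = a (Sum.inl ()) := by omega
          exact_mod_cast this
        · have : c j = 0 := by
            rcases hc j with h | h
            · exact h
            · rw [h, Function.comp_apply, hwi _ hj, Int.sign_zero]
          have := h2 j
          omega
      · have := h2 i
        rcases hc i with h | h
        · exact (hci h).elim
        · rw [Function.comp_apply, Int.sign_eq_one_of_pos hwi'] at h
          omega

/-! ### Initial ideals and toric ideals -/

open MvPolynomial in
theorem mem_initialIdeal_iff {σ K : Type*} [Field K] {m : MonomialOrder σ}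
    {I : Ideal (MvPolynomial σ K)} {p : MvPolynomial σ K} :
    p ∈ initialIdeal m I ↔ ∀ a ∈ p.support, ∃ f ∈ I, f ≠ 0 ∧ m.degree f = a := by
  have : {p | ∃ f ∈ I, f ≠ 0 ∧ p = monomial (m.degree f) (1 : K)} =
      (fun a => monomial a (1 : K)) '' {a | ∃ f ∈ I, f ≠ 0 ∧ m.degree f = a} := by
    ext p
    constructor
    · rintro ⟨f, hf, h0, rfl⟩
      exact ⟨_, ⟨f, hf, h0, rfl⟩, rfl⟩
    · rintro ⟨_, ⟨f, hf, h0, rfl⟩, rfl⟩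
      exact ⟨f, hf, h0, rfl⟩
  rw [initialIdeal, this, mem_ideal_span_monomial_image]
  refine forall₂_congr fun a _ => ⟨?_, fun h => ⟨a, h, le_rfl⟩⟩
  rintro ⟨_, ⟨f, hf, h0, rfl⟩, hle⟩
  obtain ⟨c, rfl⟩ := le_iff_exists_add.1 hle
  have hc : monomial c (1 : K) ≠ 0 := by simp
  classical
  refine ⟨f * monomial c 1, I.mul_mem_right _ hf, mul_ne_zero h0 hc, ?_⟩
  rw [m.degree_mul h0 hc, m.degree_monomial, if_neg one_ne_zero]

-- The leading exponent of f^n is n times that of f, so the hypothesis puts the leading term of f in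
-- the ideal; subtract it and induct on the number of terms.
open MvPolynomial in
theorem isRadical_initialIdeal {σ K : Type*} [Field K] {m : MonomialOrder σ}
    {I : Ideal (MvPolynomial σ K)}
    (h : ∀ (n : ℕ) (a : σ →₀ ℕ), (∃ f ∈ I, f ≠ 0 ∧ m.degree f = n • a) →
      ∃ f ∈ I, f ≠ 0 ∧ m.degree f = a) : (initialIdeal m I).IsRadical := by
  classical
  intro f hf
  induction hk : f.support.card using Nat.strong_induction_on generalizing f with
  | _ k ih =>
  rcases eq_or_ne f 0 with rfl | h0
  · exact zero_mem _
  obtain ⟨n, hn⟩ := hf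
  have hlead : monomial (m.degree f) (m.leadingCoeff f) ∈ initialIdeal m I := by
    rw [mem_initialIdeal_iff]
    intro a ha
    rw [Finset.mem_singleton.1 (support_monomial_subset ha)]
    refine h n _ (mem_initialIdeal_iff.1 hn _ ?_)
    rw [← m.degree_pow]
    exact m.degree_mem_support (pow_ne_zero _ h0)
  have hlt : (f - monomial (m.degree f) (m.leadingCoeff f)).support.card < k := by
    rw [← hk]
    refine Finset.card_lt_card ((Finset.ssubset_iff_of_subset ?_).2
      ⟨m.degree f, m.degree_mem_support h0, ?_⟩)
    · intro a ha
      rw [mem_support_iff, coeff_sub, coeff_monomial] at ha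
      rw [mem_support_iff]
      rintro h1
      split_ifs at ha with h2
      · subst h2
        exact mem_support_iff.1 (m.degree_mem_support h0) h1
      · exact ha (by simp [h1])
    · rw [notMem_support_iff, coeff_sub, coeff_monomial, if_pos rfl]
      exact sub_self _
  have := ih _ hlt (sub_mem ⟨n, hn⟩ (Ideal.le_radical hlead)) rfl
  simpa using add_mem this hlead

theorem aeval_laurentMonomial_monomial (K : Type*) [Field K] {m n : Type*} (A : Matrix m n ℤ)
    (a : n →₀ ℕ) (c : K) :
    MvPolynomial.aeval (fun j => laurentMonomial K (A.col j)) (MvPolynomial.monomial a c) =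
      AddMonoidAlgebra.single (toricDegree A a) c := by
  rw [MvPolynomial.aeval_monomial, toricDegree, Finsupp.linearCombination_apply]
  simp only [laurentMonomial, AddMonoidAlgebra.single_pow, one_pow]
  rw [AddMonoidAlgebra.finsuppProd_single, ← Algebra.smul_def, AddMonoidAlgebra.smul_single]
  simp

theorem coeff_aeval_laurentMonomial (K : Type*) [Field K] {m n : Type*} [DecidableEq (m → ℤ)]
    (A : Matrix m n ℤ) (f : MvPolynomial n K) (g : m → ℤ) :
    (MvPolynomial.aeval (fun j => laurentMonomial K (A.col j)) f).coeff g =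
      ∑ a ∈ f.support with toricDegree A a = g, f.coeff a := by
  conv_lhs => rw [f.as_sum, map_sum]
  simp only [aeval_laurentMonomial_monomial, AddMonoidAlgebra.coeff_sum, Finsupp.finsetSum_apply,
    AddMonoidAlgebra.coeff_single, Finsupp.single_apply, Finset.sum_filter]

/-- A leading term must cancel against a smaller monomial of its fibre; conversely, a difference of
two monomials of one fibre lies in the ideal. -/
theorem exists_mem_toricIdeal_degree_eq_iff (K : Type*) [Field K] {m n : Type*}
    {A : Matrix m n ℤ} {μ : MonomialOrder n} {a : n →₀ ℕ} :
    (∃ f ∈ toricIdeal K A, f ≠ 0 ∧ μ.degree f = a) ↔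
      ∃ b, toricDegree A b = toricDegree A a ∧ μ.toSyn b < μ.toSyn a := by
  classical
  constructor
  · rintro ⟨f, hf, h0, rfl⟩
    have hsum := coeff_aeval_laurentMonomial K A f (toricDegree A (μ.degree f))
    rw [(RingHom.mem_ker).1 hf] at hsum
    by_contra! hc
    rw [Finset.sum_eq_single_of_mem (μ.degree f)] at hsum
    · exact MvPolynomial.mem_support_iff.1 (μ.degree_mem_support h0) hsum.symm
    · simpa using μ.degree_mem_support h0
    · intro b hb hne
      rw [Finset.mem_filter] at hb
      exact (hne (μ.toSyn.injective ((μ.le_degree hb.1).antisymm (hc b hb.2)))).elim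
  · rintro ⟨b, hb, hlt⟩
    have hlt' : μ.toSyn (μ.degree (MvPolynomial.monomial b (1 : K))) <
        μ.toSyn (μ.degree (MvPolynomial.monomial a (1 : K))) := by
      rwa [μ.degree_monomial, μ.degree_monomial, if_neg one_ne_zero, if_neg one_ne_zero]
    have hdeg : μ.degree (MvPolynomial.monomial a (1 : K) - MvPolynomial.monomial b 1) = a := by
      rw [μ.degree_sub_of_lt hlt', μ.degree_monomial, if_neg one_ne_zero]
    refine ⟨MvPolynomial.monomial a 1 - MvPolynomial.monomial b 1, ?_, ?_, hdeg⟩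
    · rw [toricIdeal, RingHom.mem_ker, map_sub]
      erw [aeval_laurentMonomial_monomial, aeval_laurentMonomial_monomial]
      rw [hb, sub_self]
    · rw [sub_ne_zero, Ne, MvPolynomial.monomial_left_inj one_ne_zero]
      rintro rfl
      exact lt_irrefl _ hlt

theorem isRadical_initialIdeal_toricIdeal (K : Type*) [Field K] {V J : Type*} [Finite V]
    [DecidableEq V] [Finite J] {A : Matrix V J ℤ} (hA : IsNetworkMatrix A)
    {o : LinearOrder (Unit ⊕ (J ⊕ J))} (ho : ∀ j, o.le (Sum.inl ()) j) :
    (initialIdeal (revLexOrder o) (toricIdeal K (centrallySymmetric A))).IsRadical := by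
  refine isRadical_initialIdeal fun n a => ?_
  rw [exists_mem_toricIdeal_degree_eq_iff, exists_mem_toricIdeal_degree_eq_iff]
  rintro ⟨b, hb, hlt⟩
  exact exists_toricDegree_eq_lt_of_nsmul hA ho hb hlt

theorem exists_linearOrder_inl_le (J : Type*) :
    ∃ o : LinearOrder (Unit ⊕ J), ∀ j, o.le (Sum.inl ()) j := by
  let : LinearOrder J := IsWellOrder.linearOrder WellOrderingRel
  refine ⟨LinearOrder.lift' (toLex : Unit ⊕ J → Unit ⊕ₗ J) toLex.injective, ?_⟩
  rintro (⟨⟩ | j)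
  · exact le_refl (α := Unit ⊕ₗ J) _
  · exact Sum.Lex.inl_le_inr _ _

/-! ### Integral closedness via almost integral elements -/

open scoped nonZeroDivisors

/-- A subring of an integrally closed domain that contains the elements almost integral over it
is integrally closed. -/
theorem Subalgebra.isIntegrallyClosed_of_forall_mul_pow_mem {K T : Type*} [Field K] [CommRing T]
    [IsDomain T] [Algebra K T] [IsIntegrallyClosed T] (R : Subalgebra K T)
    (h : ∀ x c : T, c ≠ 0 → (∀ n : ℕ, c * x ^ n ∈ R) → x ∈ R) : IsIntegrallyClosed R := by
  rw [isIntegrallyClosed_iff (FractionRing R)]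
  intro x hx
  have hinj : Function.Injective (algebraMap R (FractionRing T)) := by
    rw [IsScalarTower.algebraMap_eq R T (FractionRing T)]
    exact (IsFractionRing.injective T (FractionRing T)).comp Subtype.val_injective
  let φ : FractionRing R →ₐ[R] FractionRing T :=
    IsFractionRing.liftAlgHom (g := Algebra.ofId R _) hinj
  -- Viewed in Frac T, `x` is integral over T, hence comes from some `y` in T.
  obtain ⟨y, hy⟩ := IsIntegrallyClosed.algebraMap_eq_of_integral (hx.map φ).tower_top (R := T)
  obtain ⟨r, hr, hrn⟩ := hx.isAlmostIntegral
  have hyR : y ∈ R := by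
    refine h y r (by simpa using nonZeroDivisors.ne_zero hr) fun n => ?_
    obtain ⟨s, hs⟩ := hrn n
    have : (r : T) * y ^ n = s := by
      apply IsFractionRing.injective T (FractionRing T)
      rw [map_mul, map_pow, hy, ← map_pow]
      have := congrArg φ hs
      rw [AlgHom.commutes, map_smul, Algebra.smul_def] at this
      exact this.symm
    rw [this]
    exact s.2
  refine ⟨⟨y, hyR⟩, φ.toRingHom.injective ?_⟩
  change φ _ = φ x
  rw [AlgHom.commutes, ← hy]
  rfl

section LeadingExponent

variable {K A B : Type*} [Field K] [AddCommMonoid A] [AddCommMonoid B] [LinearOrder B]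

/-- `a` is an exponent of `f` at which `D` is maximal. -/
def IsLeadingExponent (D : A →+ B) (f : AddMonoidAlgebra K A) (a : A) : Prop :=
  f.coeff a ≠ 0 ∧ ∀ b, f.coeff b ≠ 0 → D b ≤ D a

theorem exists_isLeadingExponent (D : A →+ B) {f : AddMonoidAlgebra K A} (hf : f ≠ 0) :
    ∃ a, IsLeadingExponent D f a := by
  obtain ⟨a, ha, h⟩ := f.coeff.support.exists_max_image D (by simpa using hf)
  exact ⟨a, by simpa using ha, fun b hb => h b (by simpa using hb)⟩

theorem IsLeadingExponent.mul [IsOrderedCancelAddMonoid B] {D : A →+ B}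
    (hD : Function.Injective D)
    {f g : AddMonoidAlgebra K A} {a b : A} (hf : IsLeadingExponent D f a)
    (hg : IsLeadingExponent D g b) : IsLeadingExponent D (f * g) (a + b) := by
  classical
  constructor
  · rw [AddMonoidAlgebra.coeff_mul_add_of_uniqueAdd]
    · exact mul_ne_zero hf.1 hg.1
    · intro x y hx hy hxy
      have h1 := hf.2 x (by simpa using hx)
      have h2 := hg.2 y (by simpa using hy)
      have h3 := congrArg D hxy
      rw [map_add, map_add] at h3
      obtain ⟨h4, h5⟩ := (add_eq_add_iff_eq_and_eq h1 h2).1 h3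
      exact ⟨hD h4, hD h5⟩
  · intro x hx
    have := AddMonoidAlgebra.support_coeff_mul_subset (x := f) (y := g)
      (Finsupp.mem_support_iff.2 hx)
    obtain ⟨y, hy, z, hz, rfl⟩ := Finset.mem_add.1 this
    rw [map_add, map_add]
    exact add_le_add (hf.2 y (by simpa using hy)) (hg.2 z (by simpa using hz))

theorem IsLeadingExponent.mul_pow [IsOrderedCancelAddMonoid B] {D : A →+ B}
    (hD : Function.Injective D)
    {f g : AddMonoidAlgebra K A} {a b : A} (hf : IsLeadingExponent D f a)
    (hg : IsLeadingExponent D g b) (n : ℕ) : IsLeadingExponent D (f * g ^ n) (a + n • b) := by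
  induction n with
  | zero => simpa using hf
  | succ n ih =>
    rw [pow_succ, ← mul_assoc, succ_nsmul, ← add_assoc]
    exact ih.mul hD hg

/-- The leading exponents s + n·g of c·h^n lie in `S`, so g does too. Expanding (h - leading term)^n
shows that the hypothesis survives removing the leading term. -/
theorem mem_of_forall_mul_pow_mem [IsOrderedCancelAddMonoid B] {D : A →+ B}
    (hD : Function.Injective D)
    {R : Subalgebra K (AddMonoidAlgebra K A)} {S : Set A}
    (hR : ∀ f, f ∈ R ↔ ∀ a, f.coeff a ≠ 0 → a ∈ S)
    (hS : ∀ s g, (∀ n : ℕ, s + n • g ∈ S) → g ∈ S) {c h : AddMonoidAlgebra K A} (hc : c ≠ 0)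
    (hch : ∀ n : ℕ, c * h ^ n ∈ R) : h ∈ R := by
  classical
  induction hk : h.coeff.support.card using Nat.strong_induction_on generalizing h with
  | _ k ih =>
  rcases eq_or_ne h 0 with rfl | h0
  · exact zero_mem _
  obtain ⟨s, hs⟩ := exists_isLeadingExponent D hc
  obtain ⟨g, hg⟩ := exists_isLeadingExponent D h0
  have hgS : g ∈ S := hS s g fun n => (hR _).1 (hch n) _ (hs.mul_pow hD hg n).1
  have hlead : AddMonoidAlgebra.single g (h.coeff g) ∈ R := by
    rw [hR]
    intro a ha
    rw [AddMonoidAlgebra.coeff_single, Finsupp.single_apply] at ha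
    split_ifs at ha with hga
    · exact hga ▸ hgS
    · exact (ha rfl).elim
  have hadd := AddMonoidAlgebra.single_add_erase g h
  have herase : h.erase g = h + -AddMonoidAlgebra.single g (h.coeff g) := by
    rw [← sub_eq_add_neg, eq_sub_iff_add_eq', hadd]
  rw [← hadd]
  refine add_mem hlead (ih _ ?_ (fun n => ?_) rfl)
  · rw [← hk, AddMonoidAlgebra.coeff_erase, Finsupp.support_erase]
    exact Finset.card_erase_lt_of_mem (by simpa using hg.1)
  · rw [herase, add_pow, Finset.mul_sum]
    refine sum_mem fun i _ => ?_
    rw [mul_assoc (h ^ i), ← mul_assoc c]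
    exact mul_mem (hch i) (mul_mem (pow_mem (neg_mem hlead) _) (natCast_mem R _))

end LeadingExponent

/-- Laurent polynomials are the localization of the polynomial ring at its monomials. -/
theorem isIntegrallyClosed_addMonoidAlgebra_pi_int (K : Type*) [Field K] (m : Type*) [Finite m] :
    IsIntegrallyClosed (AddMonoidAlgebra K (m → ℤ)) := by
  let ι : (m →₀ ℕ) →+ (m → ℤ) :=
    { toFun := fun a i => a i
      map_zero' := by ext; simp
      map_add' := fun a b => by ext; simp }
  have hι : Function.Injective ι := fun a b h => by
    ext i
    exact Nat.cast_injective (congrFun h i)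
  let φ : MvPolynomial m K →+* AddMonoidAlgebra K (m → ℤ) := AddMonoidAlgebra.mapDomainRingHom K ι
  have hφ : ∀ (a : m →₀ ℕ) (c : K),
      φ (MvPolynomial.monomial a c) = AddMonoidAlgebra.single (ι a) c :=
    fun _ _ => AddMonoidAlgebra.mapDomain_single
  have hφi : Function.Injective φ := AddMonoidAlgebra.mapDomain_injective hι
  let := φ.toAlgebra
  have : IsLocalization (MonoidHom.mrange (MvPolynomial.monomialOneHom K m))
      (AddMonoidAlgebra K (m → ℤ)) := by
    refine ⟨?_, ?_, ?_⟩
    · rintro ⟨_, a, rfl⟩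
      change IsUnit (φ (MvPolynomial.monomial _ 1))
      rw [hφ]
      refine IsUnit.of_mul_eq_one (AddMonoidAlgebra.single (-ι a.toAdd) 1) ?_
      rw [AddMonoidAlgebra.single_mul_single, add_neg_cancel, one_mul, AddMonoidAlgebra.one_def]
    · suffices h : ∀ z : AddMonoidAlgebra K (m → ℤ), ∃ (a : m →₀ ℕ) (p : MvPolynomial m K),
          z * φ (MvPolynomial.monomial a 1) = φ p by
        intro z
        obtain ⟨a, p, hp⟩ := h z
        exact ⟨⟨p, ⟨_, Multiplicative.ofAdd a, rfl⟩⟩, hp⟩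
      intro z
      induction z using AddMonoidAlgebra.induction_linear with
      | zero => exact ⟨0, 0, by simp⟩
      | add z₁ z₂ h₁ h₂ =>
        obtain ⟨a₁, p₁, h₁⟩ := h₁
        obtain ⟨a₂, p₂, h₂⟩ := h₂
        refine ⟨a₁ + a₂, p₁ * MvPolynomial.monomial a₂ 1 + p₂ * MvPolynomial.monomial a₁ 1, ?_⟩
        have : MvPolynomial.monomial (a₁ + a₂) (1 : K) =
            MvPolynomial.monomial a₁ 1 * MvPolynomial.monomial a₂ 1 := by
          rw [MvPolynomial.monomial_mul, one_mul]
        rw [this, map_add, map_mul, map_mul, map_mul, ← h₁, ← h₂]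
        ring
      | single g c =>
        refine ⟨Finsupp.equivFunOnFinite.symm fun i => (-g i).toNat,
          MvPolynomial.monomial (Finsupp.equivFunOnFinite.symm fun i => (g i).toNat) c, ?_⟩
        rw [hφ, hφ, AddMonoidAlgebra.single_mul_single, mul_one]
        congr 1
        ext i
        change g i + ((-g i).toNat : ℤ) = ((g i).toNat : ℤ)
        omega
    · intro x y hxy
      exact ⟨1, by rw [hφi hxy]⟩
  refine isIntegrallyClosed_of_isLocalization (R := MvPolynomial m K) _
    (MonoidHom.mrange (MvPolynomial.monomialOneHom K m)) ?_
  rintro _ ⟨a, rfl⟩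
  rw [mem_nonZeroDivisors_iff_ne_zero]
  exact MvPolynomial.monomial_eq_zero.not.2 one_ne_zero

/-! ### Saturation of the exponent monoid and normality -/

theorem mem_toricRing_iff {K : Type*} [Field K] {m n : Type*} {A : Matrix m n ℤ}
    {f : AddMonoidAlgebra K (m → ℤ)} :
    f ∈ toricRing K A ↔ ∀ g, f.coeff g ≠ 0 → g ∈ Set.range (toricDegree A) := by
  classical
  rw [toricRing, Algebra.adjoin_range_eq_range_aeval, AlgHom.mem_range]
  constructor
  · rintro ⟨p, rfl⟩ g hg
    rw [coeff_aeval_laurentMonomial] at hg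
    obtain ⟨a, ha, -⟩ := Finset.exists_ne_zero_of_sum_ne_zero hg
    exact ⟨a, (Finset.mem_filter.1 ha).2⟩
  · intro h
    rw [← AlgHom.mem_range, ← AddMonoidAlgebra.sum_coeff_single f]
    refine sum_mem fun g hg => ?_
    obtain ⟨a, ha⟩ := h g (by simpa using hg)
    exact ⟨MvPolynomial.monomial a (f.coeff g), by
      rw [← ha]; exact aeval_laurentMonomial_monomial K A a _⟩

/-- If a whole arithmetic progression lies in a finitely generated monoid of exponents, then so
does a positive multiple of its difference. -/
theorem exists_nsmul_mem_range_toricDegree {m n : Type*} [Finite n] {A : Matrix m n ℤ}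
    {s g : m → ℤ} (h : ∀ k : ℕ, s + k • g ∈ Set.range (toricDegree A)) :
    ∃ k : ℕ, 0 < k ∧ k • g ∈ Set.range (toricDegree A) := by
  choose c hc using h
  -- Dickson's lemma: two of the representing vectors are comparable, and their difference
  -- represents (j - i)·g.
  obtain ⟨i, j, hij, hle⟩ := wellQuasiOrdered_le c
  obtain ⟨d, hd⟩ := le_iff_exists_add.1 hle
  refine ⟨j - i, Nat.sub_pos_of_lt hij, d, ?_⟩
  have := hc j
  rw [hd, map_add, hc i, ← Nat.add_sub_cancel' hij.le, add_nsmul, ← add_assoc] at this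
  simpa using this

theorem exists_toricDegree_add_toricDegree_eq {V J : Type*} {A : Matrix V J ℤ}
    (p : Unit ⊕ (J ⊕ J) →₀ ℕ) : ∃ (N : ℕ) (q : Unit ⊕ (J ⊕ J) →₀ ℕ),
      toricDegree (centrallySymmetric A) p + toricDegree (centrallySymmetric A) q =
        toricDegree (centrallySymmetric A) (Finsupp.single (Sum.inl ()) N) := by
  induction p using Finsupp.induction_linear with
  | zero => exact ⟨0, 0, by simp⟩
  | add p₁ p₂ h₁ h₂ =>
    obtain ⟨N₁, q₁, h₁⟩ := h₁
    obtain ⟨N₂, q₂, h₂⟩ := h₂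
    refine ⟨N₁ + N₂, q₁ + q₂, ?_⟩
    rw [map_add, map_add, add_add_add_comm, h₁, h₂, Finsupp.single_add, map_add]
  | single j k =>
    -- Opposite columns (a,1) and (-a,1) add up to twice (0,1).
    refine ⟨2 * k, Finsupp.single (Sum.map id Sum.swap j) k, ?_⟩
    simp only [toricDegree, Finsupp.linearCombination_single]
    rw [mul_comm, mul_smul, ← smul_add]
    congr 1
    ext v
    rcases j with u | j | j <;> rcases v with v | v <;>
      simp [centrallySymmetric]

theorem toricDegree_centrallySymmetric_inr {V J : Type*} {A : Matrix V J ℤ}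
    (a : Unit ⊕ (J ⊕ J) →₀ ℕ) :
    toricDegree (centrallySymmetric A) a (Sum.inr ()) = (a.degree : ℤ) := by
  induction a using Finsupp.induction_linear with
  | zero => simp
  | add a b ha hb => rw [map_add, Pi.add_apply, ha, hb, map_add, Nat.cast_add]
  | single j k =>
    rw [toricDegree, Finsupp.linearCombination_single, Finsupp.degree_single]
    rcases j with u | j | j <;> simp [centrallySymmetric]

/-- The monoid generated by the columns of `A^±` is saturated. -/
theorem mem_range_toricDegree_of_forall_add_nsmul_mem {V J : Type*} [Finite V] [DecidableEq V]
    [Finite J] {A : Matrix V J ℤ} (hA : IsNetworkMatrix A) {s g : V ⊕ Unit → ℤ}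
    (h : ∀ k : ℕ, s + k • g ∈ Set.range (toricDegree (centrallySymmetric A))) :
    g ∈ Set.range (toricDegree (centrallySymmetric A)) := by
  obtain ⟨o, ho⟩ := exists_linearOrder_inl_le (J ⊕ J)
  obtain ⟨k, hk, r, hr⟩ := exists_nsmul_mem_range_toricDegree h
  obtain ⟨p, hp⟩ := h 0
  obtain ⟨q, hq⟩ := h 1
  rw [zero_nsmul, add_zero] at hp
  rw [one_nsmul] at hq
  obtain ⟨N, p', hp'⟩ := exists_toricDegree_add_toricDegree_eq (A := A) p
  set e := Finsupp.single (Sum.inl () : Unit ⊕ (J ⊕ J)) N with he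
  have hu : ∃ u, toricDegree (centrallySymmetric A) u =
      g + toricDegree (centrallySymmetric A) e := by
    refine ⟨q + p', ?_⟩
    rw [map_add, hq, ← hp', hp]
    abel
  obtain ⟨u, hu, hmin⟩ := (InvImage.wf (revLexOrder o).toSyn
    (wellFounded_lt (α := (revLexOrder o).syn))).has_min
    {u | toricDegree (centrallySymmetric A) u = g + toricDegree (centrallySymmetric A) e} hu
  -- Both vectors lie over k·(g + N·(0,1)), and `k • u` is minimal there because `u` is minimal in
  -- its fibre.
  have hle : (revLexOrder o).toSyn (k • u) ≤ (revLexOrder o).toSyn (r + k • e) := by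
    by_contra! hlt
    obtain ⟨b, hb, hb'⟩ := exists_toricDegree_eq_lt_of_nsmul hA ho (by
      rw [map_add, map_nsmul, map_nsmul, hr, hu, nsmul_add]) hlt
    exact hmin b (hb.trans hu) hb'
  -- In equal degree, the smaller monomial has at least as large an exponent at the smallest
  -- variable.
  have hz : (r + k • e) (Sum.inl ()) ≤ (k • u) (Sum.inl ()) := by
    rcases hle.eq_or_lt with heq | hlt
    · rw [(revLexOrder o).toSyn.injective heq]
    rcases (revLexOrder_lt_iff o).1 hlt with hdeg | ⟨-, i, hi, hi'⟩
    · refine absurd (congrFun (?_ : toricDegree (centrallySymmetric A) (k • u) =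
        toricDegree (centrallySymmetric A) (r + k • e)) (Sum.inr ())) ?_
      · rw [map_add, map_nsmul, map_nsmul, hr, hu, nsmul_add]
      · rw [toricDegree_centrallySymmetric_inr, toricDegree_centrallySymmetric_inr]
        exact_mod_cast hdeg.ne
    · rcases eq_or_ne (Sum.inl ()) i with rfl | hne
      · exact hi'.le
      · exact (hi _ (lt_of_le_of_ne (ho i) hne)).ge
  have hN : N ≤ u (Sum.inl ()) := by
    simp only [he, Finsupp.add_apply, Finsupp.smul_apply, Finsupp.single_eq_same, smul_eq_mul] at hz
    exact Nat.le_of_mul_le_mul_left (by omega) hk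
  obtain ⟨d, rfl⟩ := le_iff_exists_add.1 (Finsupp.single_le_iff.2 hN)
  refine ⟨d, ?_⟩
  rw [Set.mem_ofPred_eq, map_add, add_comm g] at hu
  exact add_left_cancel hu

theorem isIntegrallyClosed_toricRing (K : Type*) [Field K] {V J : Type*} [Finite V]
    [DecidableEq V] [Finite J] {A : Matrix V J ℤ} (hA : IsNetworkMatrix A) :
    IsIntegrallyClosed (toricRing K (centrallySymmetric A)) := by
  have := isIntegrallyClosed_addMonoidAlgebra_pi_int K (V ⊕ Unit)
  let : LinearOrder (V ⊕ Unit) := IsWellOrder.linearOrder WellOrderingRel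
  let D : (V ⊕ Unit → ℤ) →+ Lex (V ⊕ Unit → ℤ) :=
    { toFun := toLex, map_zero' := rfl, map_add' := fun _ _ => rfl }
  exact Subalgebra.isIntegrallyClosed_of_forall_mul_pow_mem _ fun x c hc hx =>
    mem_of_forall_mul_pow_mem (D := D) toLex.injective (fun _ => mem_toricRing_iff)
      (fun _ _ => mem_range_toricDegree_of_forall_add_nsmul_mem hA) hc hx

theorem corollary3p1 (K : Type*) [Field K] {d : ℕ} (G : SimpleGraph (Fin d)) (hG : G.Connected) :
    (∃ o : LinearOrder (Unit ⊕ (G.edgeSet ⊕ G.edgeSet)),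
      (initialIdeal (revLexOrder o)
        (toricIdeal K (centrallySymmetric (orientedIncidence G)))).IsRadical) ∧
    IsIntegrallyClosed (toricRing K (centrallySymmetric (orientedIncidence G))) := by
  obtain ⟨o, ho⟩ := exists_linearOrder_inl_le (G.edgeSet ⊕ G.edgeSet)
  exact ⟨⟨o, isRadical_initialIdeal_toricIdeal K (isNetworkMatrix_orientedIncidence G) ho⟩,
    isIntegrallyClosed_toricRing K (isNetworkMatrix_orientedIncidence G)⟩
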